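/- Identify the unit circle $\mathbb T$ with $\mathbb R/\mathbb Z$ via $\theta\mapsto e^{2\pi i\theta}$ and let $m$ be the normalized Lebesgue measure on $\mathbb T$. For a finite positive Borel measure $\rho$ on $\mathbb T$ and $n\ge 0$ put $$e_n(\rho)=\min_{q_0,\dots,q_{n-1}\in\mathbb C}\Bigl(\int_{\mathbb T}|q_0+q_1t+\dots+q_{n-1}t^{n-1}+t^n|^2\,d\rho(t)\Bigr)^{1/2},$$ with $|\log e_n(\rho)|=+\infty$ if $e_n(\rho)=0$. For a measurable $H\colon\mathbb T\to[0,+\infty]$ let $\lambda_H(a)=m\{H>a\}$. Let $\phi\colon[0,\frac12]\to(0,+\infty]$ be continuous and (strictly) decreasing with $\phi(0)=+\infty$. A function $H$ is subordinated to $\phi$ if $\phi(\frac12)\le\inf_{\mathbb T}H$ and, for every $\tau\in[-\frac12,\frac12]$, with $\theta_\tau\in[0,\frac12]$ the solution of $\phi(\theta_\tau)=H(e^{2\pi i\tau})$, $$H(e^{2\pi i\theta})\le\phi(\theta+\theta_\tau-\tau)\quad(\tau-\theta_\tau<\theta\le\tau),\qquad H(e^{2\pi i\theta})\le\phi(\tau+\theta_\tau-\theta)\quad(\tau\le\theta<\tau+\theta_\tau).$$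 For a constant $C>0$ consider the following regularity conditions on $\phi$, each required for all $\theta\in(0,\frac12]$: (Reg1) the function $\theta\mapsto\theta\phi(\theta)$ does not decrease on $(0,\frac12]$, and $\log\frac1\theta\le C\phi(\theta)$; (Reg2) $\phi(\theta/2)\le C\phi(\theta)$ and $\frac1\theta\le C\phi(\theta)$. Theorem. For every $C>0$ there is $c>0$, depending only on $C$, such that the following holds. Let $\phi$ be as above, let $H\colon\mathbb T\to[0,+\infty]$ be measurable and subordinated to $\phi$ with $\int_{\mathbb T}H\,dm=+\infty$, and let $\rho$ be a finite positive Borel measure on $\mathbb T$ with $\int_{\mathbb T}e^H\,d\rho<\infty$. (a) If $\phi$ satisfies (Reg1) with constant $C$, then for all sufficiently large $n$ the equation $n\phi^{-1}(A)=A$ has a unique solution $A=A(n)$, and $$|\log e_n(\rho)|\ge c\int_0^{A}\lambda_H(a)\,da .$$ (b) If $\phi$ satisfies (Reg2) with constant $C$, then for all sufficiently large $n$ the same inequality holds with $A=\sqrt n$. How large $n$ must be may depend on $\phi$, $H$ and $\rho$. -/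

import Mathlib

open Set Filter MeasureTheory
open scoped ENNReal

namespace SzegoMinimum

/-! The unit circle `𝕋` is identified with `ℝ / ℤ` (`UnitAddCircle`) through `θ ↦ e^{2πiθ}`
(`AddCircle.toCircle`); the normalized Lebesgue measure `m` is then `volume`. -/

/-- The quantity `e_n(ρ)`: the minimum over `q_0, …, q_{n-1} ∈ ℂ` of
`(∫_𝕋 |q_0 + q_1 t + ⋯ + q_{n-1} t^{n-1} + t^n|² dρ(t))^{1/2}`. -/
noncomputable def szegoError (ρ : Measure UnitAddCircle) (n : ℕ) : ℝ :=
  ⨅ q : Fin n → ℂ, Real.sqrt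
    (∫ x : UnitAddCircle,
      ‖(∑ k : Fin n, q k * (AddCircle.toCircle x : ℂ) ^ (k : ℕ))
        + (AddCircle.toCircle x : ℂ) ^ n‖ ^ 2 ∂ρ)

/-- `|log e_n(ρ)|` as an element of `[0, ∞]`; it is `∞` when `e_n(ρ) = 0`. -/
noncomputable def absLogSzegoError (ρ : Measure UnitAddCircle) (n : ℕ) : ℝ≥0∞ :=
  (ENNReal.log (ENNReal.ofReal (szegoError ρ n))).abs

/-- The distribution function `λ_H(a) = m{H > a}`. -/
noncomputable def distribution (H : UnitAddCircle → ℝ≥0∞) (a : ℝ) : ℝ≥0∞ :=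
  volume {x : UnitAddCircle | ENNReal.ofReal a < H x}

/-- `φ : [0, 1/2] → (0, ∞]` is continuous and decreasing with `φ(0) = ∞`
(values of `φ` outside `[0, 1/2]` play no role). -/
structure IsProfile (φ : ℝ → ℝ≥0∞) : Prop where
  continuousOn : ContinuousOn φ (Icc 0 (1 / 2))
  strictAntiOn : StrictAntiOn φ (Icc 0 (1 / 2))
  map_zero : φ 0 = ∞
  pos : ∀ θ ∈ Icc (0 : ℝ) (1 / 2), 0 < φ θ

/-- `H` is subordinated to the profile `φ`: `φ(1/2) ≤ inf H` and, for every `τ`, with `s = θ_τ`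
the solution in `[0, 1/2]` of `φ(s) = H(e^{2πiτ})`, the function `H` is bounded by `φ` as stated
on both sides of `τ`. -/
structure IsSubordinate (H : UnitAddCircle → ℝ≥0∞) (φ : ℝ → ℝ≥0∞) : Prop where
  le_inf : φ (1 / 2) ≤ ⨅ x, H x
  left : ∀ τ ∈ Icc (-(1 / 2) : ℝ) (1 / 2), ∀ s ∈ Icc (0 : ℝ) (1 / 2),
    φ s = H (τ : UnitAddCircle) →
      ∀ θ : ℝ, τ - s < θ → θ ≤ τ → H (θ : UnitAddCircle) ≤ φ (θ + s - τ)
  right : ∀ τ ∈ Icc (-(1 / 2) : ℝ) (1 / 2), ∀ s ∈ Icc (0 : ℝ) (1 / 2),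
    φ s = H (τ : UnitAddCircle) →
      ∀ θ : ℝ, τ ≤ θ → θ < τ + s → H (θ : UnitAddCircle) ≤ φ (τ + s - θ)

/-- First regularity condition, with constant `C`: `θ ↦ θ φ(θ)` does not decrease on `(0, 1/2]`
and `log (1/θ) ≤ C φ(θ)` there. -/
structure Reg1 (C : ℝ) (φ : ℝ → ℝ≥0∞) : Prop where
  mono : MonotoneOn (fun θ : ℝ => ENNReal.ofReal θ * φ θ) (Ioc 0 (1 / 2))
  log_le : ∀ θ ∈ Ioc (0 : ℝ) (1 / 2),
    ENNReal.ofReal (Real.log (1 / θ)) ≤ ENNReal.ofReal C * φ θ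

/-- Second regularity condition, with constant `C`: `φ(θ/2) ≤ C φ(θ)` and `1/θ ≤ C φ(θ)`
on `(0, 1/2]`. -/
structure Reg2 (C : ℝ) (φ : ℝ → ℝ≥0∞) : Prop where
  doubling : ∀ θ ∈ Ioc (0 : ℝ) (1 / 2), φ (θ / 2) ≤ ENNReal.ofReal C * φ θ
  inv_le : ∀ θ ∈ Ioc (0 : ℝ) (1 / 2),
    ENNReal.ofReal (1 / θ) ≤ ENNReal.ofReal C * φ θ

/-- `A` solves the equation `n φ⁻¹(A) = A`: the number `s = φ⁻¹(A)`, that is the point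
`s ∈ [0, 1/2]` with `φ(s) = A`, exists and satisfies `n s = A`. -/
def SolvesLevelEquation (φ : ℝ → ℝ≥0∞) (n : ℕ) (A : ℝ) : Prop :=
  0 ≤ A ∧ ∃ s ∈ Icc (0 : ℝ) (1 / 2), φ s = ENNReal.ofReal A ∧ (n : ℝ) * s = A

end SzegoMinimum

namespace SzegoMinimum

/-! Reversing coefficients on the circle shows that a polynomial `p` of degree at most `n` with
`p(0) > 0` gives `e_n(ρ) ≤ ‖p‖ / p(0)`, the norm being that of `L²(ρ)`. So one wants `p` dominated
by `2 e^{H/2}` on the circle, which keeps its norm bounded, yet large at the origin.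

Put `h = min(H, A)` and let `F` be the outer function with boundary modulus `e^{εh}`; then `F(0) =
e^{ε∫h}`. Take for `p` the Taylor polynomial of `F(rz)`, with `1 - r` comparable to `t = A/n`. The
remainder is at most `e^{εA} r^{n+1}/(1 - r) ≤ 1`. On the circle, `log |F(rz)|` is `ε` times a
Poisson average of `h`. Subordination makes `h` at most `D h(x)` within distance `s/2` of `x`, where
`φ(s) = H(x)`; the rest of the circle contributes at most a multiple of `A t / s`. If `A t` is at
most a multiple of `s φ(s)`, the average is at most a multiple of `h(x)`, and a small `ε` brings it
down to `h(x)/2` (`exists_polynomial_dominated`).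

Hence `e_n(ρ) ≤ S e^{-ε∫h}` with `S` independent of `n`. As `∫H = ∞`, half of the exponent absorbs
`S` (`exists_le_absLogSzegoError`), and the layer cake formula turns `∫h` into the integral of the
distribution function. The regularity conditions enter only through doubling of `φ`, the comparison
of `A t` with `s φ(s)`, and a bound on `log (1/t)`. -/

/-! ### Taylor polynomials of bounded analytic functions on the disc -/

open Metric Real in
theorem norm_iteratedDeriv_le_of_forall_mem_unitBall {f : ℂ → ℂ} {M : ℝ}
    (hf : DifferentiableOn ℂ f (ball 0 1)) (hM : ∀ z ∈ ball (0 : ℂ) 1, ‖f z‖ ≤ M) (k : ℕ) :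
    ‖iteratedDeriv k f 0‖ ≤ k.factorial * M := by
  have hlim : Tendsto (fun R : ℝ => k.factorial * M / R ^ k) (nhdsWithin 1 (Iio 1))
      (nhds (k.factorial * M / 1 ^ k)) := by
    apply Tendsto.mono_left _ nhdsWithin_le_nhds
    apply ContinuousAt.tendsto (f := fun R : ℝ => k.factorial * M / R ^ k)
    fun_prop (disch := simp)
  rw [one_pow, div_one] at hlim
  -- Nothing is known on the unit circle itself, so Cauchy's estimate is used on radius `R < 1` and
  -- `R` tends to `1`.
  refine ge_of_tendsto hlim ?_
  filter_upwards [Ioo_mem_nhdsLT (zero_lt_one' ℝ)] with R hR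
  refine Complex.norm_iteratedDeriv_le_of_forall_mem_sphere_norm_le k hR.1 ?_ ?_
  · apply DifferentiableOn.diffContOnCl
    rw [closure_ball _ hR.1.ne']
    exact hf.mono (closedBall_subset_ball hR.2)
  · intro z hz
    exact hM z (sphere_subset_ball hR.2 hz)

open Metric in
/-- The remainder of a Taylor polynomial of a bounded analytic function on the unit disc. -/
theorem norm_sub_taylor_le {f : ℂ → ℂ} {M : ℝ} (hf : DifferentiableOn ℂ f (ball 0 1))
    (hM : ∀ z ∈ ball (0 : ℂ) 1, ‖f z‖ ≤ M) {w : ℂ} (hw : ‖w‖ < 1) (N : ℕ) :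
    ‖f w - ∑ k ∈ Finset.range N, ((k.factorial : ℂ)⁻¹ * iteratedDeriv k f 0) * w ^ k‖
      ≤ M * ‖w‖ ^ N / (1 - ‖w‖) := by
  have hs := Complex.hasSum_taylorSeries_on_ball hf (z := w) (by simpa using hw)
  have hs' : HasSum (fun k : ℕ => ((k.factorial : ℂ)⁻¹ * iteratedDeriv k f 0) * w ^ k) (f w) := by
    have he : (fun k : ℕ => ((k.factorial : ℂ)⁻¹ * iteratedDeriv k f 0) * w ^ k) =
        fun k : ℕ => (k.factorial : ℂ)⁻¹ • (w - 0) ^ k • iteratedDeriv k f 0 := by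
      ext k
      rw [sub_zero, smul_eq_mul, smul_eq_mul]; ring
    rwa [he]
  have hg : HasSum (fun k : ℕ => M * ‖w‖ ^ N * ‖w‖ ^ k) (M * ‖w‖ ^ N / (1 - ‖w‖)) := by
    rw [div_eq_mul_inv]
    exact (hasSum_geometric_of_lt_one (norm_nonneg w) hw).mul_left _
  refine ((hasSum_nat_add_iff' N).2 hs').norm_le_of_bounded hg fun k => ?_
  have hk := norm_iteratedDeriv_le_of_forall_mem_unitBall hf hM (k + N)
  have hpos : (0 : ℝ) < (k + N).factorial := by exact_mod_cast Nat.factorial_pos _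
  rw [norm_mul, norm_mul, norm_inv, norm_pow, Complex.norm_natCast, mul_assoc M, ← pow_add,
    add_comm N k]
  gcongr
  rw [inv_mul_le_iff₀ hpos]
  exact hk

/-! ### Poisson averages and outer functions -/

open Metric Real in
theorem circleAverage_poissonKernel {w : ℂ} (hw : w ∈ ball (0 : ℂ) 1) :
    circleAverage (poissonKernel 0 w) 0 1 = 1 := by
  have h := DiffContOnCl.circleAverage_poissonKernel_smul (f := fun _ : ℂ => (1 : ℂ))
    (c := 0) (R := 1) diffContOnCl_const hw
  rw [circleAverage_def] at h ⊢
  simp only [Pi.smul_apply', Complex.real_smul, mul_one] at h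
  rw [intervalIntegral.integral_ofReal] at h
  exact_mod_cast h

open Metric Real in
theorem circleIntegrable_of_bounded {g : ℂ → ℝ} {A : ℝ} (hg : Measurable g)
    (hA : ∀ z, |g z| ≤ A) : CircleIntegrable g 0 1 := by
  unfold CircleIntegrable
  refine (intervalIntegrable_const (c := A)).mono_fun ?_ ?_
  · exact (hg.comp (by fun_prop)).aestronglyMeasurable
  · exact Eventually.of_forall fun θ => (hA _).trans (le_abs_self A)

open Metric Real in
theorem circleIntegrable_poissonKernel_smul {g : ℂ → ℝ} {w : ℂ} (hg : CircleIntegrable g 0 1)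
    (hw : w ∈ ball (0 : ℂ) 1) : CircleIntegrable (poissonKernel 0 w • g) 0 1 := by
  refine hg.continuousOn_smul ?_
  rw [poissonKernel_eq_re_herglotzRieszKernel]
  exact Complex.continuous_re.comp_continuousOn (continuousOn_herglotzRieszKernel_sphere hw)

open Metric in
theorem poissonKernel_nonneg {w z : ℂ} (hw : w ∈ ball (0 : ℂ) 1) (hz : z ∈ sphere (0 : ℂ) 1) :
    0 ≤ poissonKernel 0 w z := by
  rw [mem_ball_zero_iff] at hw
  rw [mem_sphere_zero_iff_norm] at hz
  rw [poissonKernel_def, sub_zero, sub_zero, hz]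
  have : ‖w‖ ^ 2 ≤ 1 := pow_le_one₀ (norm_nonneg _) hw.le
  have : (0 : ℝ) ≤ 1 ^ 2 - ‖w‖ ^ 2 := by linarith
  positivity

open Metric Real in
theorem circleAverage_poissonKernel_smul_le {g : ℂ → ℝ} {A : ℝ} (hg : Measurable g)
    (h0 : ∀ z, 0 ≤ g z) (hA : ∀ z, g z ≤ A) {w : ℂ} (hw : w ∈ ball (0 : ℂ) 1) :
    circleAverage (poissonKernel 0 w • g) 0 1 ≤ A := by
  have hgi := circleIntegrable_of_bounded hg fun z => (abs_of_nonneg (h0 z)).trans_le (hA z)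
  have h1 := circleIntegrable_poissonKernel_smul hgi hw
  have hc : CircleIntegrable (fun _ : ℂ => A) 0 1 := circleIntegrable_const _ _ _
  have h2 := circleIntegrable_poissonKernel_smul hc hw
  have h3 : circleAverage (poissonKernel 0 w • fun _ : ℂ => A) 0 1 = A := by
    have : (poissonKernel 0 w • fun _ : ℂ => A) = A • poissonKernel 0 w := by
      ext z; simp [mul_comm]
    rw [this, circleAverage_smul, circleAverage_poissonKernel hw]; simp
  rw [← h3]
  refine circleAverage_mono h1 h2 fun z hz => ?_
  rw [abs_one] at hz
  exact mul_le_mul_of_nonneg_left (hA z) (poissonKernel_nonneg hw hz)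

open Metric Real in
/-- Taylor polynomials of the outer function with boundary modulus `e^g`. -/
theorem exists_polynomial_of_boundary_function {g : ℂ → ℝ} {A r : ℝ} (hg : Measurable g)
    (h0 : ∀ z, 0 ≤ g z) (hA : ∀ z, g z ≤ A) (hr0 : 0 < r) (hr1 : r < 1) (n : ℕ) :
    ∃ p : ℕ → ℂ, p 0 = (rexp (circleAverage g 0 1) : ℝ) ∧ ∀ z : ℂ, ‖z‖ = 1 →
      ‖∑ k ∈ Finset.range (n + 1), p k * z ^ k‖
        ≤ rexp (circleAverage (poissonKernel 0 (r * z) • g) 0 1)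
          + rexp A * r ^ (n + 1) / (1 - r) := by
  have hgi := circleIntegrable_of_bounded hg fun z => (abs_of_nonneg (h0 z)).trans_le (hA z)
  have hgi' : CircleIntegrable (fun ζ => (g ζ : ℂ)) 0 1 := by
    simp only [CircleIntegrable, intervalIntegrable_iff] at hgi ⊢
    exact Complex.ofRealCLM.integrable_comp hgi
  -- The Herglotz integral: its real part is the Poisson integral of `g`, so `exp U` is the outer
  -- function with boundary modulus `e^g`.
  set U : ℂ → ℂ := fun w => circleAverage (fun ζ => herglotzRieszKernel 0 w ζ • (g ζ : ℂ)) 0 1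
    with hU
  have hre : ∀ w ∈ ball (0 : ℂ) 1, ‖Complex.exp (U w)‖ =
      rexp (circleAverage (poissonKernel 0 w • g) 0 1) := by
    intro w hw
    rw [Complex.norm_exp, hU, re_circleAverage_herglotzRieszKernel_smul hgi hw,
      poissonKernel_eq_re_herglotzRieszKernel]
  have hd : DifferentiableOn ℂ (fun w => Complex.exp (U w)) (ball 0 1) :=
    (differentiableOn_circleAverage_herglotzRieszKernel_smul hgi').cexp
  have hM : ∀ w ∈ ball (0 : ℂ) 1, ‖Complex.exp (U w)‖ ≤ rexp A := by
    intro w hw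
    rw [hre w hw]
    exact exp_le_exp.2 (circleAverage_poissonKernel_smul_le hg h0 hA hw)
  have hU0 : U 0 = (circleAverage g 0 1 : ℝ) := by
    have : U 0 = circleAverage (fun ζ => (g ζ : ℂ)) 0 1 := by
      refine circleAverage_congr_sphere fun z hz => ?_
      rw [abs_one, mem_sphere_zero_iff_norm] at hz
      have hz0 : z ≠ 0 := by rintro rfl; simp at hz
      simp [herglotzRieszKernel_def, hz0]
    rw [this, circleAverage_def, circleAverage_def, intervalIntegral.integral_ofReal]
    simp
  -- These are the Taylor coefficients of `exp (U (r * z))`; the dilation turns the remainder into a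
  -- geometric tail in `r`.
  refine ⟨fun k => ((k.factorial : ℂ)⁻¹ * iteratedDeriv k (fun w => Complex.exp (U w)) 0) * r ^ k,
    ?_, fun z hz => ?_⟩
  · simp [hU0]
  · have hw : ‖(r * z : ℂ)‖ = r := by simp [hz, abs_of_pos hr0]
    have ht := norm_sub_taylor_le hd hM (w := r * z) (by rw [hw]; exact hr1) (n + 1)
    rw [hw] at ht
    rw [← hre (r * z) (by rw [mem_ball_zero_iff, hw]; exact hr1)]
    simp only [mul_pow, ← mul_assoc] at ht
    have := norm_le_norm_add_norm_sub' (∑ k ∈ Finset.range (n + 1),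
      ((k.factorial : ℂ)⁻¹ * iteratedDeriv k (fun w => Complex.exp (U w)) 0) * r ^ k * z ^ k)
      (Complex.exp (U (r * z)))
    rw [norm_sub_rev] at this
    linarith

/-! ### Local estimates for the Poisson kernel -/

open Real in
theorem circleAverage_eq_integral_symm (f : ℂ → ℝ) (θ : ℝ) :
    circleAverage f 0 1
      = ∫ y in (-(1 / 2) : ℝ)..(1 / 2), f (circleMap 0 1 (2 * π * y + 2 * π * θ)) := by
  have hp : Function.Periodic (fun t => f (circleMap 0 1 t)) (2 * π) :=
    (periodic_circleMap 0 1).comp f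
  rw [intervalIntegral.integral_comp_mul_add (fun t => f (circleMap 0 1 t)) (by positivity),
    circleAverage_def]
  congr 1
  have := hp.intervalIntegral_add_eq 0 (2 * π * -(1 / 2) + 2 * π * θ)
  rw [zero_add] at this
  rw [this]
  congr 1
  ring

open Real in
theorem norm_circleMap_sub_sq (r y θ : ℝ) :
    ‖circleMap 0 1 (y + θ) - r * circleMap 0 1 θ‖ ^ 2 = (1 - r) ^ 2 + 2 * r * (1 - cos y) := by
  have h : circleMap 0 1 (y + θ) - r * circleMap 0 1 θ =
      circleMap 0 1 θ * (Complex.exp (y * Complex.I) - r) := by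
    simp only [circleMap, Complex.ofReal_one, one_mul, zero_add, Complex.ofReal_add, add_mul,
      Complex.exp_add]
    ring
  rw [h, norm_mul, norm_circleMap_zero, abs_one, one_mul, ← Complex.normSq_eq_norm_sq,
    Complex.normSq_apply]
  simp only [Complex.sub_re, Complex.exp_ofReal_mul_I_re, Complex.ofReal_re, Complex.sub_im,
    Complex.exp_ofReal_mul_I_im, Complex.ofReal_im, sub_zero]
  nlinarith [Real.sin_sq_add_cos_sq y]

open Real in
-- The denominator of the kernel is at least `4 y²`, hence at least `2 (y² + (s/2)²)` in this range,
-- and `1 - r² ≤ 2 (1 - r)`. Keeping `(s/2)²` makes the majorant integrable across `y = 0`, so the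
-- tail can be integrated over the whole period.
theorem poissonKernel_circleMap_le {r s y θ : ℝ} (hr : 1 / 4 ≤ r) (hr1 : r < 1) (hs : 0 < s)
    (hy : |y| ≤ 1 / 2) (hsy : s / 2 ≤ |y|) :
    poissonKernel 0 (r * circleMap 0 1 (2 * π * θ)) (circleMap 0 1 (2 * π * y + 2 * π * θ))
      ≤ (1 - r) / (y ^ 2 + (s / 2) ^ 2) := by
  have hcos : cos (2 * π * y) ≤ 1 - 8 * y ^ 2 := by
    have := cos_le_one_sub_mul_cos_sq (x := 2 * π * y) (by
      rw [abs_mul, abs_of_pos two_pi_pos]; nlinarith [pi_pos])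
    have h2 : 2 / π ^ 2 * (2 * π * y) ^ 2 = 8 * y ^ 2 := by field_simp; ring
    linarith
  have hy2 : (s / 2) ^ 2 ≤ y ^ 2 := by
    rw [← sq_abs y]; gcongr
  have hpos : 0 < (s / 2) ^ 2 := by positivity
  rw [poissonKernel_def, sub_zero, sub_zero, norm_circleMap_sub_sq, norm_mul, norm_circleMap_zero,
    norm_circleMap_zero, Complex.norm_real, abs_one, mul_one, norm_eq_abs, sq_abs]
  have h4 : 4 * y ^ 2 ≤ (1 - r) ^ 2 + 2 * r * (1 - cos (2 * π * y)) := by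
    nlinarith [mul_nonneg (sub_nonneg.2 hr) (sq_nonneg y), mul_le_mul_of_nonneg_left hcos
      (by linarith : 0 ≤ 2 * r)]
  rw [div_le_div_iff₀ (by linarith) (by linarith)]
  have h5 : 2 * (y ^ 2 + (s / 2) ^ 2) ≤ (1 - r) ^ 2 + 2 * r * (1 - cos (2 * π * y)) := by linarith
  have h6 : (1 ^ 2 - r ^ 2) * (y ^ 2 + (s / 2) ^ 2) ≤ (1 - r) * (2 * (y ^ 2 + (s / 2) ^ 2)) := by
    nlinarith [mul_nonneg (mul_nonneg (sub_nonneg.2 hr1.le) (sub_nonneg.2 hr1.le))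
      (add_nonneg (sq_nonneg y) hpos.le)]
  exact h6.trans (mul_le_mul_of_nonneg_left h5 (by linarith))

open Real in
theorem integral_inv_sq_add_sq_le {a : ℝ} (ha : 0 < a) :
    ∫ y in (-(1 / 2) : ℝ)..(1 / 2), 1 / (y ^ 2 + a ^ 2) ≤ π / a := by
  have hd : ∀ y ∈ uIcc (-(1 / 2) : ℝ) (1 / 2),
      HasDerivAt (fun y => arctan (y / a) / a) (1 / (y ^ 2 + a ^ 2)) y := by
    intro y _
    have h1 := (((hasDerivAt_id y).div_const a).arctan).div_const a
    have h2 : 1 / (y ^ 2 + a ^ 2) = 1 / (1 + (y / a) ^ 2) * (1 / a) / a := by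
      field_simp
      ring
    rw [h2]
    exact h1
  have hpos : ∀ y : ℝ, y ^ 2 + a ^ 2 ≠ 0 := fun y => by positivity
  rw [intervalIntegral.integral_eq_sub_of_hasDerivAt hd
    (Continuous.intervalIntegrable (by fun_prop (disch := exact hpos _)) _ _), ← sub_div]
  gcongr
  linarith [arctan_lt_pi_div_two ((1 / 2) / a), neg_pi_div_two_lt_arctan (-(1 / 2) / a)]

open Real Metric in
/-- The Poisson average at distance `1 - r` from a boundary point is controlled by the values of
the boundary function at distance at most `s / 2` and a tail. -/
theorem circleAverage_poissonKernel_smul_le_add {g : ℂ → ℝ} {A B r s θ : ℝ} (hg : Measurable g)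
    (h0 : ∀ z, 0 ≤ g z) (hA : ∀ z, g z ≤ A) (hr : 1 / 4 ≤ r) (hr1 : r < 1) (hs : 0 < s)
    (hB : 0 ≤ B)
    (hnear : ∀ y : ℝ, |y| < s / 2 → g (circleMap 0 1 (2 * π * y + 2 * π * θ)) ≤ B) :
    circleAverage (poissonKernel 0 (r * circleMap 0 1 (2 * π * θ)) • g) 0 1
      ≤ B + 8 * A * (1 - r) / s := by
  have hA0 : 0 ≤ A := (h0 0).trans (hA 0)
  set w : ℂ := r * circleMap 0 1 (2 * π * θ) with hw_def
  have hw : w ∈ ball (0 : ℂ) 1 := by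
    rw [mem_ball_zero_iff, hw_def, norm_mul, norm_circleMap_zero, Complex.norm_real, abs_one,
      mul_one, norm_of_nonneg (by linarith)]
    exact hr1
  have hint : ∀ F : ℂ → ℝ, CircleIntegrable F 0 1 → IntervalIntegrable
      (fun y => F (circleMap 0 1 (2 * π * y + 2 * π * θ))) volume (-(1 / 2)) (1 / 2) := by
    intro F hF
    have hp : Function.Periodic (fun t => F (circleMap 0 1 t)) (2 * π) :=
      (periodic_circleMap 0 1).comp F
    have h1 := hp.intervalIntegrable₀ two_pi_pos.ne' hF
      (2 * π * (-(1 / 2)) + 2 * π * θ) (2 * π * (1 / 2) + 2 * π * θ)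
    have h2 := (h1.comp_add_right (2 * π * θ)).comp_mul_left (c := 2 * π)
    convert h2 using 1 <;> field_simp <;> ring
  have hgi := circleIntegrable_of_bounded hg fun z => (abs_of_nonneg (h0 z)).trans_le (hA z)
  have hPg := hint _ (circleIntegrable_poissonKernel_smul hgi hw)
  have hP : IntervalIntegrable (fun y => poissonKernel 0 w
      (circleMap 0 1 (2 * π * y + 2 * π * θ))) volume (-(1 / 2)) (1 / 2) := by
    have h := hint _ (circleIntegrable_poissonKernel_smul (circleIntegrable_const (1 : ℝ) 0 1) hw)
    simpa using h
  have hne : ∀ y : ℝ, y ^ 2 + (s / 2) ^ 2 ≠ 0 := fun y => by positivity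
  have hT : IntervalIntegrable (fun y : ℝ => 1 / (y ^ 2 + (s / 2) ^ 2)) volume
      (-(1 / 2)) (1 / 2) :=
    Continuous.intervalIntegrable (by fun_prop (disch := exact hne _)) _ _
  have hone : ∫ y in (-(1 / 2) : ℝ)..(1 / 2),
      poissonKernel 0 w (circleMap 0 1 (2 * π * y + 2 * π * θ)) = 1 := by
    rw [← circleAverage_eq_integral_symm, circleAverage_poissonKernel hw]
  -- Pointwise majorant: the term with `B` serves for `|y| < s/2`, the other one for the remaining
  -- `y`.
  have hmono := intervalIntegral.integral_mono_on (by norm_num) hPg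
    ((hP.const_mul B).add (hT.const_mul (A * (1 - r)))) (fun y hy => ?_)
  · rw [circleAverage_eq_integral_symm _ θ]
    refine hmono.trans ?_
    rw [intervalIntegral.integral_add (hP.const_mul B) (hT.const_mul _),
      intervalIntegral.integral_const_mul, intervalIntegral.integral_const_mul, hone, mul_one]
    gcongr
    have h1 := integral_inv_sq_add_sq_le (a := s / 2) (by positivity)
    have h2 : 0 ≤ A * (1 - r) := mul_nonneg hA0 (by linarith)
    calc _ ≤ A * (1 - r) * (π / (s / 2)) := mul_le_mul_of_nonneg_left h1 h2
      _ = A * (1 - r) * (2 * π) / s := by field_simp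
      _ ≤ A * (1 - r) * 8 / s := by gcongr; linarith [pi_lt_four]
      _ = _ := by ring
  · have hPn : 0 ≤ poissonKernel 0 w (circleMap 0 1 (2 * π * y + 2 * π * θ)) :=
      poissonKernel_nonneg hw (circleMap_mem_sphere _ zero_le_one _)
    have hr' : 0 ≤ 1 - r := by linarith
    have hTn : 0 ≤ 1 / (y ^ 2 + (s / 2) ^ 2) := by positivity
    rw [Pi.smul_apply', smul_eq_mul]
    by_cases hys : |y| < s / 2
    · have := mul_le_mul_of_nonneg_left (hnear y hys) hPn
      nlinarith [mul_nonneg (mul_nonneg hA0 hr') hTn]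
    · have h1 := poissonKernel_circleMap_le (θ := θ) hr hr1 hs
        (abs_le.2 ⟨hy.1, hy.2⟩) (not_lt.1 hys)
      have h2 := mul_le_mul_of_nonneg_left (hA (circleMap 0 1 (2 * π * y + 2 * π * θ))) hPn
      have h3 := mul_le_mul_of_nonneg_left h1 hA0
      have h4 := mul_nonneg hB hPn
      have h5 : A * ((1 - r) / (y ^ 2 + (s / 2) ^ 2)) =
        A * (1 - r) * (1 / (y ^ 2 + (s / 2) ^ 2)) := by ring
      simp only [← hw_def] at h3
      linarith

/-! ### Polynomials dominated on the circle -/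

open Real in
theorem toCircle_coe_eq_circleMap (x : ℝ) :
    (AddCircle.toCircle (x : UnitAddCircle) : ℂ) = circleMap 0 1 (2 * π * x) := by
  rw [AddCircle.toCircle_apply_mk, Circle.coe_exp, circleMap]
  simp

-- Lets a function on `ℝ / ℤ` be read as a measurable function on `ℂ` through the argument.
open Real in
theorem coe_arg_circleMap (x : ℝ) :
    ((((circleMap 0 1 (2 * π * x)).arg / (2 * π) : ℝ)) : UnitAddCircle) = (x : UnitAddCircle) := by
  apply AddCircle.injective_toCircle one_ne_zero
  apply Subtype.ext
  rw [toCircle_coe_eq_circleMap, toCircle_coe_eq_circleMap, mul_div_cancel₀ _ (by positivity)]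
  have := Complex.norm_mul_exp_arg_mul_I (circleMap 0 1 (2 * π * x))
  rw [norm_circleMap_zero, abs_one, Complex.ofReal_one, one_mul] at this
  have hexp : ∀ a : ℝ, circleMap 0 1 a = Complex.exp (a * Complex.I) := fun a => by
    simp [circleMap]
  rw [hexp (circleMap 0 1 (2 * π * x)).arg]
  exact this

open Real in
/-- Polynomials of degree at most `n` that are dominated by `e^{h/2}` on the circle and large at
the origin, for a function `h` which is regular at the scale `1 / t`. -/
theorem exists_polynomial_dominated {D : ℝ} (hD : 1 ≤ D) :
    ∃ ε : ℝ, 0 < ε ∧ ∀ (h : UnitAddCircle → ℝ) (A t : ℝ) (n : ℕ), Measurable h →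
      (∀ x, 0 ≤ h x) → (∀ x, h x ≤ A) → 0 < t → (D + 1) * t ≤ 3 / 4 → n * t = A →
      Real.log (1 / t) ≤ D * A →
      (∀ x : ℝ, h x < A → ∃ s : ℝ, 0 < s ∧
        (∀ y : ℝ, |y| < s / 2 → h ((y + x : ℝ) : UnitAddCircle) ≤ D * h x) ∧
        A * t ≤ D * s * h x) →
      ∃ p : ℕ → ℂ, p 0 = (rexp (ε * ∫ x, h x) : ℝ) ∧ ∀ x : UnitAddCircle,
        ‖∑ k ∈ Finset.range (n + 1), p k * (AddCircle.toCircle x : ℂ) ^ k‖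
          ≤ 2 * rexp (h x / 2) := by
  -- The Poisson average of `h` will be at most `E * h x`: `D` comes from nearby points and `8 (D +
  -- 1) D` from the tail. Then `ε = 1 / (2E)` yields the exponent `h x / 2`.
  set E : ℝ := D + 8 * (D + 1) * D with hE
  have hE1 : 1 ≤ E := by nlinarith
  refine ⟨1 / (2 * E), by positivity, fun h A t n hm h0 hA ht htD hnt hlog hreg => ?_⟩
  set ε : ℝ := 1 / (2 * E) with hε
  have hε0 : 0 < ε := by positivity
  have hεE : ε * E = 1 / 2 := by rw [hε]; field_simp
  have hε1 : ε ≤ 1 := by nlinarith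
  have hA0 : 0 ≤ A := (h0 0).trans (hA 0)
  set b : ℂ → ℝ := fun ζ => h ((ζ.arg / (2 * π) : ℝ) : UnitAddCircle) with hb
  have hbm : Measurable b :=
    hm.comp (AddCircle.measurable_mk'.comp (Complex.measurable_arg.div_const _))
  have hbx : ∀ x : ℝ, b (circleMap 0 1 (2 * π * x)) = h x := fun x => by
    rw [hb]; simp only [coe_arg_circleMap]
  -- With `n t = A` this gives `r ^ n ≤ e^{-(D+1)A}`, which beats both `e^{εA}` and `1 / (1 - r) ≤ 1
  -- / t ≤ e^{DA}`. The bound on `(D + 1) * t` ensures `r ≥ 1/4`.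
  set r : ℝ := 1 - (D + 1) * t with hr
  have hKt : 0 < (D + 1) * t := by positivity
  obtain ⟨p, hp0, hp⟩ := exists_polynomial_of_boundary_function (g := ε • b) (A := ε * A) (r := r)
    (hbm.const_smul ε) (fun z => mul_nonneg hε0.le (h0 _))
    (fun z => mul_le_mul_of_nonneg_left (hA _) hε0.le) (by linarith) (by linarith) n
  refine ⟨p, ?_, fun x => ?_⟩
  · rw [hp0, Real.circleAverage_smul, circleAverage_eq_integral_symm b 0, smul_eq_mul]
    have h1 := UnitAddCircle.intervalIntegral_preimage (-(1 / 2)) h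
    rw [← h1]
    norm_num [hbx]
  · induction x using QuotientAddGroup.induction_on with
    | H x =>
    rw [toCircle_coe_eq_circleMap]
    refine (hp _ (by simp)).trans ?_
    have hpois : circleAverage (poissonKernel 0 (r * circleMap 0 1 (2 * π * x)) • b) 0 1
        ≤ E * h x := by
      by_cases hx : h x < A
      · obtain ⟨s, hs, hnear, hfar⟩ := hreg x hx
        have h1 := circleAverage_poissonKernel_smul_le_add (θ := x) (r := r) hbm (fun z => h0 _)
          (fun z => hA _) (by linarith) (by linarith) hs
          (mul_nonneg (by linarith) (h0 x) : 0 ≤ D * h x) (fun y hy => by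
            rw [← mul_add, hbx]; exact hnear y hy)
        refine h1.trans ?_
        have h2 : 8 * A * (1 - r) / s ≤ 8 * (D + 1) * D * h x := by
          rw [div_le_iff₀ hs, hr]
          have := mul_le_mul_of_nonneg_left hfar (by linarith : 0 ≤ 8 * (D + 1))
          linarith
        rw [hE]; linarith
      -- Where `h x` attains the cap `A`, the trivial bound of the average by `A` suffices.
      · have h1 : circleAverage (poissonKernel 0 (r * circleMap 0 1 (2 * π * x)) • b) 0 1 ≤ A := by
          refine circleAverage_poissonKernel_smul_le hbm (fun z => h0 _) (fun z => hA _) ?_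
          rw [mem_ball_zero_iff, norm_mul, norm_circleMap_zero, Complex.norm_real, abs_one,
            mul_one, norm_of_nonneg (by linarith)]
          linarith
        have h2 : A ≤ h x := not_lt.1 hx
        nlinarith [h0 x]
    have hmain : rexp (circleAverage
        (poissonKernel 0 (r * circleMap 0 1 (2 * π * x)) • ε • b) 0 1) ≤ rexp (h x / 2) := by
      rw [smul_comm, Real.circleAverage_smul, exp_le_exp, smul_eq_mul]
      have := mul_le_mul_of_nonneg_left hpois hε0.le
      rw [← mul_assoc, hεE] at this
      linarith
    have herr : rexp (ε * A) * r ^ (n + 1) / (1 - r) ≤ 1 := by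
      have h1 : 1 - r = (D + 1) * t := by rw [hr]; ring
      have h2 : r ^ (n + 1) ≤ rexp (-((D + 1) * A)) := by
        calc r ^ (n + 1) ≤ r ^ n := pow_le_pow_of_le_one (by linarith) (by linarith) n.le_succ
          _ ≤ rexp (-((D + 1) * t)) ^ n := by
              gcongr
              · linarith
              · linarith [add_one_le_exp (-((D + 1) * t))]
          _ = rexp (-((D + 1) * A)) := by
              rw [← exp_nat_mul, ← hnt]; congr 1; ring
      have h3 : 1 / t ≤ rexp (D * A) := by
        rw [← exp_log (by positivity : 0 < 1 / t)]; exact exp_le_exp.2 hlog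
      have h4 : 1 / (1 - r) ≤ rexp (D * A) := by
        refine le_trans ?_ h3
        rw [h1]
        gcongr
        nlinarith
      calc rexp (ε * A) * r ^ (n + 1) / (1 - r)
          = rexp (ε * A) * r ^ (n + 1) * (1 / (1 - r)) := by ring
        _ ≤ rexp (ε * A) * rexp (-((D + 1) * A)) * rexp (D * A) := by
          gcongr
          rw [h1]; positivity
        _ = rexp ((ε - 1) * A) := by rw [← exp_add, ← exp_add]; congr 1; ring
        _ ≤ 1 := by
          rw [exp_le_one_iff]
          exact mul_nonpos_of_nonpos_of_nonneg (by linarith) hA0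
    have hone : 1 ≤ rexp (h x / 2) := one_le_exp (by linarith [h0 x])
    linarith

/-! ### From dominated polynomials to `|log e_n|` -/

/-- A polynomial of degree at most `n` that is large at the origin bounds `e_n`, through its
reversal. -/
theorem szegoError_le_of_polynomial {ρ : Measure UnitAddCircle} {n : ℕ} {p : ℕ → ℂ} {a : ℝ}
    (ha : 0 < a) (hp : p 0 = a) {G : UnitAddCircle → ℝ≥0∞} (hG : (∫⁻ x, G x ∂ρ) < ∞)
    (hpG : ∀ x : UnitAddCircle, ENNReal.ofReal
      (‖∑ k ∈ Finset.range (n + 1), p k * (AddCircle.toCircle x : ℂ) ^ k‖ ^ 2) ≤ 4 * G x) :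
    szegoError ρ n ≤ 2 * Real.sqrt (∫⁻ x, G x ∂ρ).toReal / a := by
  -- On `|z| = 1` the reversed polynomial is `z ^ n` times the conjugate of `p(z)`, divided by `a`;
  -- it is monic because `p 0 = a` is real.
  have hpoly : ∀ x : UnitAddCircle,
      ‖(∑ k : Fin n, (star (p (n - k)) / a) * (AddCircle.toCircle x : ℂ) ^ (k : ℕ))
        + (AddCircle.toCircle x : ℂ) ^ n‖ =
      ‖∑ k ∈ Finset.range (n + 1), p k * (AddCircle.toCircle x : ℂ) ^ k‖ / a := by
    intro x
    set z : ℂ := (AddCircle.toCircle x : ℂ) with hz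
    have hz1 : ‖z‖ = 1 := Circle.norm_coe _
    have hzz : star z * z = 1 := by
      rw [Complex.star_def, Complex.conj_mul', hz1]; simp
    have ha' : (a : ℂ) ≠ 0 := by exact_mod_cast ha.ne'
    have h1 : (∑ k : Fin n, (star (p (n - k)) / a) * z ^ (k : ℕ)) + z ^ n =
        ∑ k ∈ Finset.range (n + 1), (star (p (n - k)) / a) * z ^ k := by
      rw [Finset.sum_range_succ, Fin.sum_univ_eq_sum_range
        (fun k => (star (p (n - k)) / a) * z ^ k)]
      simp [hp, ha']
    have h2 : ∑ k ∈ Finset.range (n + 1), (star (p (n - k)) / a) * z ^ k =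
        z ^ n / a * star (∑ k ∈ Finset.range (n + 1), p k * z ^ k) := by
      rw [← Finset.sum_range_reflect, star_sum, Finset.mul_sum]
      refine Finset.sum_congr rfl fun k hk => ?_
      have hk' : k ≤ n := Nat.lt_succ_iff.1 (Finset.mem_range.1 hk)
      have e1 : n + 1 - 1 - k = n - k := by omega
      have e2 : n - (n - k) = k := by omega
      have e3 : z ^ n = z ^ (n - k) * z ^ k := by rw [← pow_add]; congr 1; omega
      have e4 : z ^ k * star z ^ k = 1 := by rw [← mul_pow, mul_comm, hzz, one_pow]
      rw [e1, e2, e3, star_mul', star_pow]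
      linear_combination (-(star (p k) / a * z ^ (n - k))) * e4
    rw [h1, h2, norm_mul, norm_div, norm_pow, hz1, norm_star, Complex.norm_real,
      Real.norm_of_nonneg ha.le]
    ring
  have hle : szegoError ρ n ≤ Real.sqrt (∫ x : UnitAddCircle,
      ‖(∑ k : Fin n, (star (p (n - k)) / a) * (AddCircle.toCircle x : ℂ) ^ (k : ℕ))
        + (AddCircle.toCircle x : ℂ) ^ n‖ ^ 2 ∂ρ) :=
    ciInf_le (f := fun q : Fin n → ℂ => Real.sqrt (∫ x : UnitAddCircle,
      ‖(∑ k : Fin n, q k * (AddCircle.toCircle x : ℂ) ^ (k : ℕ))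
        + (AddCircle.toCircle x : ℂ) ^ n‖ ^ 2 ∂ρ))
      ⟨0, by rintro _ ⟨q, rfl⟩; exact Real.sqrt_nonneg _⟩ fun k => star (p (n - k)) / a
  refine hle.trans ?_
  simp only [hpoly, div_pow]
  rw [integral_div]
  have hint : ∫ x : UnitAddCircle,
      ‖∑ k ∈ Finset.range (n + 1), p k * (AddCircle.toCircle x : ℂ) ^ k‖ ^ 2 ∂ρ ≤
      4 * (∫⁻ x, G x ∂ρ).toReal := by
    have hcont : Continuous fun x : UnitAddCircle =>
        ‖∑ k ∈ Finset.range (n + 1), p k * (AddCircle.toCircle x : ℂ) ^ k‖ ^ 2 := by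
      have := AddCircle.continuous_toCircle (T := 1)
      fun_prop
    rw [integral_eq_lintegral_of_nonneg_ae (Eventually.of_forall fun x => by positivity)
      hcont.aestronglyMeasurable]
    have h4 : (∫⁻ x, ENNReal.ofReal
        (‖∑ k ∈ Finset.range (n + 1), p k * (AddCircle.toCircle x : ℂ) ^ k‖ ^ 2) ∂ρ) ≤
        4 * ∫⁻ x, G x ∂ρ := by
      rw [← lintegral_const_mul' _ _ (by norm_num)]
      exact lintegral_mono hpG
    have h5 := ENNReal.toReal_mono (ENNReal.mul_ne_top (by norm_num) hG.ne) h4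
    rwa [ENNReal.toReal_mul] at h5
  calc _ ≤ Real.sqrt (4 * (∫⁻ x, G x ∂ρ).toReal / a ^ 2) := by gcongr
    _ = _ := by
      rw [Real.sqrt_div (by positivity), Real.sqrt_sq ha.le, Real.sqrt_mul (by norm_num)]
      congr 2
      rw [show (4 : ℝ) = 2 ^ 2 by norm_num, Real.sqrt_sq (by norm_num)]

theorem ofReal_le_absLogSzegoError {ρ : Measure UnitAddCircle} {n : ℕ} {b : ℝ} (hb : 0 ≤ b)
    (h : szegoError ρ n ≤ Real.exp (-b)) : ENNReal.ofReal b ≤ absLogSzegoError ρ n := by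
  unfold absLogSzegoError
  rw [ENNReal.log_ofReal]
  split_ifs with h0
  · simp
  · rw [EReal.abs_def]
    apply ENNReal.ofReal_le_ofReal
    have := (Real.log_le_iff_le_exp (not_le.1 h0)).2 h
    rw [abs_of_nonpos (by linarith)]
    linarith

/-- Layer cake formula for the truncation: for `0 < a < A`, a point with `H > a` also has `min(H, A)
> a`. -/
theorem lintegral_distribution_le {H : UnitAddCircle → ℝ≥0∞} (hH : Measurable H) (A : ℝ) :
    (∫⁻ a in Ioc 0 A, distribution H a) ≤ ∫⁻ x, min (H x) (ENNReal.ofReal A) := by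
  have hm : Measurable fun x => (min (H x) (ENNReal.ofReal A)).toReal :=
    (hH.min measurable_const).ennreal_toReal
  have hfin : ∀ x, min (H x) (ENNReal.ofReal A) ≠ ∞ := fun x =>
    ((min_le_right _ _).trans_lt ENNReal.ofReal_lt_top).ne
  have h := lintegral_eq_lintegral_meas_lt (volume : Measure UnitAddCircle)
    (Eventually.of_forall fun x => ENNReal.toReal_nonneg) hm.aemeasurable
  simp only [ENNReal.ofReal_toReal (hfin _)] at h
  rw [h]
  refine le_trans ?_ (lintegral_mono_set (s := Ioc 0 A) Ioc_subset_Ioi_self)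
  rw [restrict_Ioo_eq_restrict_Ioc.symm]
  refine setLIntegral_mono' measurableSet_Ioo fun a ha => measure_mono fun x hx => ?_
  change a < (min (H x) (ENNReal.ofReal A)).toReal
  rw [← ENNReal.ofReal_lt_iff_lt_toReal ha.1.le (hfin x)]
  exact lt_min hx ((ENNReal.ofReal_lt_ofReal_iff (ha.1.trans ha.2)).2 ha.2)

theorem tendsto_lintegral_min {H : UnitAddCircle → ℝ≥0∞} (hH : Measurable H)
    (hi : (∫⁻ x, H x) = ∞) :
    Tendsto (fun k : ℕ => ∫⁻ x, min (H x) (ENNReal.ofReal k)) atTop (nhds ∞) := by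
  rw [← hi]
  refine lintegral_tendsto_of_tendsto_of_monotone
    (fun k => (hH.min measurable_const).aemeasurable)
    (Eventually.of_forall fun x i j hij => by dsimp only; gcongr)
    (Eventually.of_forall fun x => ?_)
  have h1 : Tendsto (fun k : ℕ => ENNReal.ofReal (k : ℝ)) atTop (nhds ∞) :=
    ENNReal.tendsto_ofReal_atTop.comp tendsto_natCast_atTop_atTop
  simpa using tendsto_const_nhds.min h1

/-- The main estimate: the lower bound for `|log e_n|` when `H` is regular below the level `A`. -/
theorem exists_le_absLogSzegoError {D : ℝ} (hD : 1 ≤ D) :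
    ∃ c : ℝ, 0 < c ∧ ∀ (H : UnitAddCircle → ℝ≥0∞) (ρ : Measure UnitAddCircle), Measurable H →
      (∫⁻ x, H x) = ∞ → (∫⁻ x, EReal.exp (H x : EReal) ∂ρ) < ∞ →
      ∃ A₀ : ℝ, 0 < A₀ ∧ ∀ (A t : ℝ) (n : ℕ), A₀ ≤ A → 0 < t → (D + 1) * t ≤ 3 / 4 → n * t = A →
        Real.log (1 / t) ≤ D * A →
        (∀ x : ℝ, H x < ENNReal.ofReal A → ∃ s : ℝ, 0 < s ∧
          (∀ y : ℝ, |y| < s / 2 → H ((y + x : ℝ) : UnitAddCircle) ≤ ENNReal.ofReal D * H x) ∧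
          ENNReal.ofReal (A * t) ≤ ENNReal.ofReal (D * s) * H x) →
        ENNReal.ofReal c * (∫⁻ a in Ioc 0 A, distribution H a) ≤ absLogSzegoError ρ n := by
  obtain ⟨ε, hε, hpoly⟩ := exists_polynomial_dominated hD
  refine ⟨ε / 2, by positivity, fun H ρ hH hi hexp => ?_⟩
  set S : ℝ := 2 * Real.sqrt (∫⁻ x, EReal.exp (H x : EReal) ∂ρ).toReal with hS
  have hS0 : 0 ≤ S := by positivity
  -- Chosen so that `L ≥ L₀` gives `S ≤ ε L / 2 ≤ e^{εL/2}`, whence `S e^{-εL} ≤ e^{-εL/2}`.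
  set L₀ : ℝ := 2 * S / ε with hL₀
  obtain ⟨k, hk1, hk2⟩ := (((tendsto_order.1 (tendsto_lintegral_min hH hi)).1
    (ENNReal.ofReal L₀) ENNReal.ofReal_lt_top).and (eventually_gt_atTop 0)).exists
  refine ⟨k, by exact_mod_cast hk2, fun A t n hkA ht htD hnt hlog hreg => ?_⟩
  have hA0 : 0 ≤ A := (Nat.cast_nonneg k).trans hkA
  have hfin : ∀ x, min (H x) (ENNReal.ofReal A) ≠ ∞ := fun x =>
    ((min_le_right _ _).trans_lt ENNReal.ofReal_lt_top).ne
  set h : UnitAddCircle → ℝ := fun x => (min (H x) (ENNReal.ofReal A)).toReal with hh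
  have hm : Measurable h := (hH.min measurable_const).ennreal_toReal
  have h0 : ∀ x, 0 ≤ h x := fun x => ENNReal.toReal_nonneg
  have hA : ∀ x, h x ≤ A := fun x =>
    ENNReal.toReal_le_of_le_ofReal hA0 (min_le_right _ _)
  have hlt : ∀ x, h x < A → H x < ENNReal.ofReal A := by
    intro x hx
    by_contra hcon
    rw [hh] at hx
    simp only [min_eq_right (not_lt.1 hcon), ENNReal.toReal_ofReal hA0, lt_irrefl] at hx
  have hval : ∀ x, H x < ENNReal.ofReal A → h x = (H x).toReal := fun x hx => by
    rw [hh]; simp only [min_eq_left hx.le]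
  obtain ⟨p, hp0, hp⟩ := hpoly h A t n hm h0 hA ht htD hnt hlog (fun x hx => by
    have hHx := hlt _ hx
    obtain ⟨s, hs, hnear, hfar⟩ := hreg x hHx
    refine ⟨s, hs, fun y hy => ?_, ?_⟩
    · have h1 := (min_le_left _ (ENNReal.ofReal A)).trans (hnear y hy)
      have h2 := ENNReal.toReal_mono (ENNReal.mul_ne_top ENNReal.ofReal_ne_top hHx.ne_top) h1
      rwa [ENNReal.toReal_mul, ENNReal.toReal_ofReal (by linarith), ← hval _ hHx] at h2
    · have h2 := ENNReal.toReal_mono (ENNReal.mul_ne_top ENNReal.ofReal_ne_top hHx.ne_top) hfar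
      rwa [ENNReal.toReal_mul, ENNReal.toReal_ofReal (by positivity),
        ENNReal.toReal_ofReal (by positivity), ← hval _ hHx] at h2)
  set L : ℝ := ∫ x, h x with hL
  have hLl : ENNReal.ofReal L = ∫⁻ x, min (H x) (ENNReal.ofReal A) := by
    have hint : Integrable h :=
      (integrable_const A).mono' hm.aestronglyMeasurable
        (Eventually.of_forall fun x => by rw [Real.norm_of_nonneg (h0 x)]; exact hA x)
    rw [hL, ofReal_integral_eq_lintegral_ofReal hint (Eventually.of_forall h0)]
    simp only [hh, ENNReal.ofReal_toReal (hfin _)]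
  have hL0 : 0 ≤ L := integral_nonneg h0
  have hLL₀ : L₀ ≤ L := by
    rw [← ENNReal.ofReal_le_ofReal_iff hL0, hLl]
    refine hk1.le.trans (lintegral_mono fun x => ?_)
    gcongr
  have herr := szegoError_le_of_polynomial (ρ := ρ) (n := n) (Real.exp_pos _) hp0 hexp (by
    intro x
    have h1 : ‖∑ k ∈ Finset.range (n + 1), p k * (AddCircle.toCircle x : ℂ) ^ k‖ ^ 2 ≤
        4 * Real.exp (h x) := by
      calc _ ≤ (2 * Real.exp (h x / 2)) ^ 2 := by gcongr; exact hp x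
        _ = 4 * Real.exp (h x) := by
          rw [mul_pow, ← Real.exp_nat_mul]; norm_num; ring_nf
    refine (ENNReal.ofReal_le_ofReal h1).trans ?_
    rw [ENNReal.ofReal_mul (by norm_num), ENNReal.ofReal_ofNat, ← EReal.exp_coe]
    have h2 : EReal.exp (h x : EReal) ≤ EReal.exp (H x : EReal) := by
      refine EReal.exp_monotone ?_
      rw [hh, EReal.coe_ennreal_toReal (hfin x)]
      exact EReal.coe_ennreal_le_coe_ennreal_iff.2 (min_le_left _ _)
    gcongr)
  have hfinal : szegoError ρ n ≤ Real.exp (-(ε / 2 * L)) := by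
    refine herr.trans ?_
    rw [← hS, div_le_iff₀ (Real.exp_pos _), ← Real.exp_add]
    have h1 : S ≤ ε / 2 * L := by
      have : ε / 2 * L₀ = S := by rw [hL₀]; field_simp
      rw [← this]; gcongr
    have h2 : -(ε / 2 * L) + ε * L = ε / 2 * L := by ring
    rw [h2]
    linarith [Real.add_one_le_exp (ε / 2 * L)]
  refine le_trans ?_ (ofReal_le_absLogSzegoError (by positivity) hfinal)
  rw [ENNReal.ofReal_mul (by positivity), hLl]
  gcongr
  exact lintegral_distribution_le hH A

/-! ### Profiles, subordination and the level equation -/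

theorem IsProfile.lt_top {φ : ℝ → ℝ≥0∞} (hφ : IsProfile φ) {s : ℝ} (hs : s ∈ Ioc (0 : ℝ) (1 / 2)) :
    φ s < ∞ := by
  rw [← hφ.map_zero]
  exact hφ.strictAntiOn ⟨le_rfl, by norm_num⟩ ⟨hs.1.le, hs.2⟩ hs.1

theorem IsProfile.exists_eq {φ : ℝ → ℝ≥0∞} (hφ : IsProfile φ) {v : ℝ≥0∞} (hv : φ (1 / 2) ≤ v)
    (hv' : v < ∞) : ∃ s ∈ Ioc (0 : ℝ) (1 / 2), φ s = v := by
  obtain ⟨s, hs, rfl⟩ := intermediate_value_Icc' (by norm_num : (0 : ℝ) ≤ 1 / 2) hφ.continuousOn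
    ⟨hv, by rw [hφ.map_zero]; exact le_top⟩
  refine ⟨s, ⟨lt_of_le_of_ne hs.1 ?_, hs.2⟩, rfl⟩
  rintro rfl
  exact hv'.ne hφ.map_zero

/-- Subtracting the nearest integer moves `x` into `[-1/2, 1/2]`, and the two one-sided bounds merge
into one in `|y|`. -/
theorem IsSubordinate.exists_radius {φ : ℝ → ℝ≥0∞} {H : UnitAddCircle → ℝ≥0∞} (hφ : IsProfile φ)
    (hH : IsSubordinate H φ) (x : ℝ) (hx : H x < ∞) :
    ∃ s ∈ Ioc (0 : ℝ) (1 / 2), φ s = H x ∧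
      ∀ y : ℝ, |y| < s → H ((y + x : ℝ) : UnitAddCircle) ≤ φ (s - |y|) := by
  obtain ⟨s, hs, hsx⟩ := hφ.exists_eq (hH.le_inf.trans (iInf_le _ (x : UnitAddCircle))) hx
  refine ⟨s, hs, hsx, fun y hy => ?_⟩
  have hround : ((round x : ℝ) : UnitAddCircle) = 0 :=
    (AddCircle.coe_eq_zero_iff 1).2 ⟨round x, by simp⟩
  set τ : ℝ := x - round x with hτ
  have hτm : τ ∈ Icc (-(1 / 2) : ℝ) (1 / 2) := abs_le.1 (abs_sub_round x)
  have hτx : ∀ y : ℝ, ((y + x : ℝ) : UnitAddCircle) = ((τ + y : ℝ) : UnitAddCircle) := fun y => by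
    rw [hτ, show x - round x + y = y + x - round x by ring, AddCircle.coe_sub, hround, sub_zero]
  have hτ0 : φ s = H (τ : UnitAddCircle) := by
    have := hτx 0
    rw [zero_add, add_zero] at this
    rw [hsx, this]
  rw [hτx]
  rcases le_total 0 y with h0 | h0
  · rw [abs_of_nonneg h0] at hy ⊢
    have := hH.right τ hτm s ⟨hs.1.le, hs.2⟩ hτ0 (τ + y) (by linarith) (by linarith)
    rwa [show τ + s - (τ + y) = s - y by ring] at this
  · rw [abs_of_nonpos h0] at hy ⊢
    have := hH.left τ hτm s ⟨hs.1.le, hs.2⟩ hτ0 (τ + y) (by linarith) (by linarith)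
    rwa [show τ + y + s - τ = s - -y by ring] at this

/-- Under a doubling condition, `H` is controlled at distance comparable to `φ⁻¹(H)`. -/
theorem IsSubordinate.exists_radius_of_doubling {φ : ℝ → ℝ≥0∞} {H : UnitAddCircle → ℝ≥0∞} {D : ℝ}
    (hφ : IsProfile φ) (hH : IsSubordinate H φ)
    (hD : ∀ s ∈ Ioc (0 : ℝ) (1 / 2), φ (s / 2) ≤ ENNReal.ofReal D * φ s) (x : ℝ) (hx : H x < ∞) :
    ∃ s ∈ Ioc (0 : ℝ) (1 / 2), φ s = H x ∧
      ∀ y : ℝ, |y| < s / 2 → H ((y + x : ℝ) : UnitAddCircle) ≤ ENNReal.ofReal D * H x := by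
  obtain ⟨s, hs, hsx, hnear⟩ := hH.exists_radius hφ x hx
  refine ⟨s, hs, hsx, fun y hy => (hnear y (by linarith [hs.1])).trans ?_⟩
  rw [← hsx]
  refine le_trans (hφ.strictAntiOn.antitoneOn ⟨?_, ?_⟩ ⟨?_, ?_⟩ ?_) (hD s hs) <;>
    linarith [hs.1, hs.2, abs_nonneg y]

/-- Monotonicity of `θ φ(θ)` between `s/2` and `s`, after cancelling `s/2`. -/
theorem Reg1.doubling {C : ℝ} {φ : ℝ → ℝ≥0∞} (h : Reg1 C φ) {s : ℝ}
    (hs : s ∈ Ioc (0 : ℝ) (1 / 2)) : φ (s / 2) ≤ 2 * φ s := by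
  have h1 := h.mono (a := s / 2) (b := s) ⟨by linarith [hs.1], by linarith [hs.1, hs.2]⟩ hs
    (by linarith [hs.1])
  have h2 : ENNReal.ofReal s = ENNReal.ofReal (s / 2) * 2 := by
    rw [← ENNReal.ofReal_ofNat, ← ENNReal.ofReal_mul (by linarith [hs.1])]
    congr 1; ring
  dsimp only at h1
  rw [h2, mul_assoc] at h1
  exact (ENNReal.mul_le_mul_iff_right (by simpa using hs.1) ENNReal.ofReal_ne_top).1 h1

/-- A larger solution `A = n s` would have a larger `s`, hence a smaller value `φ(s) = A`. -/
theorem SolvesLevelEquation.unique {φ : ℝ → ℝ≥0∞} (hφ : IsProfile φ) {n : ℕ} {A A' : ℝ}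
    (h : SolvesLevelEquation φ n A) (h' : SolvesLevelEquation φ n A') : A = A' := by
  have key : ∀ A A' : ℝ, SolvesLevelEquation φ n A → SolvesLevelEquation φ n A' → A ≤ A' := by
    rintro A A' ⟨h0, s, hs, hsA, hn⟩ ⟨h0', s', hs', hsA', hn'⟩
    by_contra! hlt
    have hss : s' ≤ s := by
      by_contra! hss
      have : (n : ℝ) * s ≤ n * s' := by gcongr
      linarith
    have := hφ.strictAntiOn.antitoneOn hs' hs hss
    rw [hsA, hsA', ENNReal.ofReal_le_ofReal_iff h0'] at this
    linarith
  exact le_antisymm (key A A' h h') (key A' A h' h)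

/-- The graphs of `n s` and `φ(s)` cross on `[0, 1/2]`: `φ` is infinite at `0`, and `n / 2 ≥ φ(1/2)`
for large `n`. -/
theorem exists_solvesLevelEquation {φ : ℝ → ℝ≥0∞} (hφ : IsProfile φ) :
    ∀ᶠ n : ℕ in atTop, ∃ A : ℝ, SolvesLevelEquation φ n A := by
  have hfin : φ (1 / 2) < ∞ := hφ.lt_top ⟨by norm_num, le_rfl⟩
  filter_upwards [eventually_ge_atTop ⌈2 * (φ (1 / 2)).toReal⌉₊] with n hn
  have hn' : 2 * (φ (1 / 2)).toReal ≤ n := Nat.ceil_le.1 hn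
  obtain ⟨s, hs, hsn⟩ := isPreconnected_Icc.intermediate_value₂
    (s := Icc (0 : ℝ) (1 / 2)) (f := fun s => ENNReal.ofReal (n * s)) (g := φ)
    ⟨le_rfl, by norm_num⟩ ⟨by norm_num, le_rfl⟩
    (ENNReal.continuous_ofReal.comp (by fun_prop)).continuousOn hφ.continuousOn
    (by rw [hφ.map_zero]; exact le_top)
    (by rw [← ENNReal.ofReal_toReal hfin.ne]; apply ENNReal.ofReal_le_ofReal; linarith)
  have := hs.1
  exact ⟨n * s, by positivity, s, hs, hsn.symm, rfl⟩

/-- The solutions of the level equation `n φ⁻¹(A) = A` satisfy `A → ∞` and `φ⁻¹(A) → 0`. -/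
theorem eventually_level_large {φ : ℝ → ℝ≥0∞} (hφ : IsProfile φ) (A₀ : ℝ) {δ : ℝ}
    (hδ : δ ∈ Ioc (0 : ℝ) (1 / 2)) :
    ∀ᶠ n : ℕ in atTop, ∀ t ∈ Icc (0 : ℝ) (1 / 2), φ t = ENNReal.ofReal (n * t) →
      A₀ ≤ n * t ∧ t ≤ δ := by
  have hfin : φ (1 / 2) < ∞ := hφ.lt_top ⟨by norm_num, le_rfl⟩
  -- The maximum with `φ (1 / 2)` only ensures that the level is attained. If `n t < A₀`, then `φ t
  -- ≤ φ s`, so `t ≥ s` and `n t ≥ n s ≥ A₀`, a contradiction.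
  obtain ⟨s, hs, hsv⟩ := hφ.exists_eq (v := max (φ (1 / 2)) (ENNReal.ofReal A₀)) (le_max_left _ _)
    (max_lt hfin ENNReal.ofReal_lt_top)
  filter_upwards [eventually_ge_atTop ⌈A₀ / s⌉₊, eventually_ge_atTop ⌈(φ δ).toReal / δ⌉₊]
    with n hn1 hn2 t ht htn
  have h1 : A₀ ≤ n * s := (div_le_iff₀ hs.1).1 (Nat.ceil_le.1 hn1)
  have h2 : (φ δ).toReal ≤ n * δ := (div_le_iff₀ hδ.1).1 (Nat.ceil_le.1 hn2)
  have hn0 : (0 : ℝ) ≤ n * t := mul_nonneg n.cast_nonneg ht.1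
  constructor
  · by_contra! hlt
    have h3 : φ t ≤ φ s := by
      rw [htn, hsv]
      exact (ENNReal.ofReal_le_ofReal hlt.le).trans (le_max_right _ _)
    have h4 : s ≤ t := (hφ.strictAntiOn.le_iff_ge ht ⟨hs.1.le, hs.2⟩).1 h3
    have : (n : ℝ) * s ≤ n * t := by gcongr
    linarith
  · by_contra! hlt
    have h3 := hφ.strictAntiOn ⟨hδ.1.le, hδ.2⟩ ht hlt
    rw [htn, ENNReal.ofReal_lt_iff_lt_toReal hn0 (hφ.lt_top hδ).ne] at h3
    have : (n : ℝ) * δ ≤ n * t := by gcongr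
    linarith

end SzegoMinimum

/-! ### The two regularity regimes -/

theorem mainTheorem3 (C : ℝ) (hC : 0 < C) :
    ∃ c : ℝ, 0 < c ∧
      ∀ (φ : ℝ → ℝ≥0∞) (H : UnitAddCircle → ℝ≥0∞) (ρ : Measure UnitAddCircle)
        [IsFiniteMeasure ρ],
        SzegoMinimum.IsProfile φ →
        Measurable H →
        (∫⁻ x, H x) = ∞ →
        SzegoMinimum.IsSubordinate H φ →
        (∫⁻ x, EReal.exp (H x : EReal) ∂ρ) < ∞ →
        (SzegoMinimum.Reg1 C φ →
          ∀ᶠ n : ℕ in atTop,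
            (∃! A : ℝ, SzegoMinimum.SolvesLevelEquation φ n A) ∧
            ∀ A : ℝ, SzegoMinimum.SolvesLevelEquation φ n A →
              ENNReal.ofReal c * (∫⁻ a in Ioc 0 A, SzegoMinimum.distribution H a)
                ≤ SzegoMinimum.absLogSzegoError ρ n) ∧
        (SzegoMinimum.Reg2 C φ →
          ∀ᶠ n : ℕ in atTop,
            ENNReal.ofReal c *
                (∫⁻ a in Ioc 0 (Real.sqrt n), SzegoMinimum.distribution H a)
              ≤ SzegoMinimum.absLogSzegoError ρ n) := by
  -- The value `2` is the doubling constant under `Reg1`; a single `D`, hence a single `c`, serves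
  -- both cases.
  set D : ℝ := max C 2 with hDdef
  have hD2 : 2 ≤ D := le_max_right _ _
  have hCD : C ≤ D := le_max_left _ _
  obtain ⟨c, hc, hmain⟩ := SzegoMinimum.exists_le_absLogSzegoError (by linarith : 1 ≤ D)
  refine ⟨c, hc, fun φ H ρ _ hφ hH hi hsub hexp => ?_⟩
  obtain ⟨A₀, hA₀, hA⟩ := hmain H ρ hH hi hexp
  refine ⟨fun hreg => ?_, fun hreg => ?_⟩
  · have hδ0 : 0 < 3 / (4 * (D + 1)) := by positivity
    have hδ : 3 / (4 * (D + 1)) ∈ Ioc (0 : ℝ) (1 / 2) :=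
      ⟨hδ0, by rw [div_le_iff₀ (by positivity)]; linarith⟩
    filter_upwards [SzegoMinimum.exists_solvesLevelEquation hφ,
      SzegoMinimum.eventually_level_large hφ A₀ hδ] with n ⟨A, hnA⟩ hlarge
    refine ⟨⟨A, hnA, fun A' hA' => hA'.unique hφ hnA⟩, ?_⟩
    rintro A ⟨hA0, t, ht, htA, hnt⟩
    obtain ⟨hA₀A, htδ⟩ := hlarge t ht (by rw [htA, hnt])
    rw [hnt] at hA₀A
    have ht0 : 0 < t := by
      refine lt_of_le_of_ne ht.1 ?_
      rintro rfl
      exact ENNReal.ofReal_ne_top (htA.symm.trans hφ.map_zero)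
    refine hA A t n hA₀A ht0 ?_ hnt ?_ fun x hx => ?_
    · rw [le_div_iff₀ (by positivity)] at htδ
      linarith
    · have h1 := hreg.log_le t ⟨ht0, ht.2⟩
      rw [htA, ← ENNReal.ofReal_mul hC.le, ENNReal.ofReal_le_ofReal_iff (by positivity)] at h1
      exact h1.trans (by gcongr)
    · obtain ⟨s, hs, hsx, hnear⟩ := hsub.exists_radius_of_doubling (D := D) hφ
        (fun s hs => (hreg.doubling hs).trans (by
          gcongr
          rw [← ENNReal.ofReal_ofNat]
          exact ENNReal.ofReal_le_ofReal hD2)) x (hx.trans ENNReal.ofReal_lt_top)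
      refine ⟨s, hs.1, hnear, ?_⟩
      have hts : t < s := by
        rw [← hsx, ← htA] at hx
        exact (hφ.strictAntiOn.lt_iff_gt ⟨hs.1.le, hs.2⟩ ht).1 hx
      -- Since `A = φ(t)` and `t < s`, monotonicity of `θ φ(θ)` gives `A t ≤ s φ(s) = s H(x)`.
      have h1 := hreg.mono ⟨ht0, ht.2⟩ hs hts.le
      dsimp only at h1
      rw [htA, hsx, ← ENNReal.ofReal_mul ht.1, mul_comm t A] at h1
      refine h1.trans ?_
      gcongr
      nlinarith [hs.1]
  · filter_upwards [eventually_ge_atTop 1, eventually_ge_atTop ⌈A₀ ^ 2⌉₊,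
      eventually_ge_atTop ⌈(4 * (D + 1) / 3) ^ 2⌉₊] with n hn1 hn2 hn3
    have hn : (1 : ℝ) ≤ n := by exact_mod_cast hn1
    have hsq : 0 < Real.sqrt n := Real.sqrt_pos.2 (by linarith)
    -- With `t = 1 / √n` both `n t = A` and `A t = 1` hold, so the comparison with `s φ(s)` is
    -- exactly what `1/s ≤ C φ(s)` supplies.
    refine hA (Real.sqrt n) (1 / Real.sqrt n) n (Real.le_sqrt_of_sq_le (Nat.ceil_le.1 hn2))
      (by positivity) ?_ ?_ ?_ fun x hx => ?_
    · have h1 : 4 * (D + 1) / 3 ≤ Real.sqrt n := Real.le_sqrt_of_sq_le (Nat.ceil_le.1 hn3)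
      rw [mul_one_div, div_le_iff₀ hsq]
      linarith
    · rw [mul_one_div, Real.div_sqrt]
    · rw [one_div_one_div]
      nlinarith [Real.log_le_sub_one_of_pos hsq]
    · obtain ⟨s, hs, hsx, hnear⟩ := hsub.exists_radius_of_doubling (D := D) hφ
        (fun s hs => (hreg.doubling s hs).trans (by gcongr)) x (hx.trans ENNReal.ofReal_lt_top)
      refine ⟨s, hs.1, hnear, ?_⟩
      have hs0 := hs.1
      rw [mul_one_div_cancel hsq.ne', ← hsx]
      calc ENNReal.ofReal 1 = ENNReal.ofReal s * ENNReal.ofReal (1 / s) := by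
            rw [← ENNReal.ofReal_mul hs.1.le, mul_one_div_cancel hs.1.ne']
        _ ≤ ENNReal.ofReal s * (ENNReal.ofReal C * φ s) := by gcongr; exact hreg.inv_le s hs
        _ ≤ ENNReal.ofReal s * (ENNReal.ofReal D * φ s) := by gcongr
        _ = ENNReal.ofReal (D * s) * φ s := by
            rw [mul_comm D s, ENNReal.ofReal_mul hs.1.le, mul_assoc]
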